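/- All Hilbert spaces are complex. Two subspaces $U,W$ of a Hilbert space are called $\varepsilon$-orthogonal ($\varepsilon\ge 0$) if $|\langle u,w\rangle|\le\varepsilon\|u\|\|w\|$ for all $u\in U$, $w\in W$. Two subgroups $H,K$ of a group $G$ with $G=\langle H,K\rangle$ are called $\varepsilon$-orthogonal if for every unitary representation $V$ of $G$ without nonzero $G$-invariant vectors the subspaces $V^H$ and $V^K$ of $H$-invariant and of $K$-invariant vectors are $\varepsilon$-orthogonal. Let $G$ be a group, nilpotent of class at most two, generated by abelian subgroups $X$ and $Y$. Let $A$ be an associative ring with $1$ such that $G$ is a Noetherian $A$-group; that is, $X$ is a Noetherian right $A$-module, $Y$ is a Noetherian left $A$-module, and $[xr,y]=[x,ry]$ for all $r\in A$, $x\in X$, $y\in Y$. Let $m\in\{2,3,\dots\}\cup\{\infty\}$ be the smallest index of a proper $A$-submodule of $X$ (with $m=\infty$ if $X$ has no proper $A$-submodule of finite index). Then $X$ and $Y$ are $\frac1{\sqrt m}$-orthogonal, where $\frac1{\sqrt\infty}=0$. -/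

import Mathlib

open scoped ENNReal IsMulCommutative commutatorElement

/-- A unitary representation of an abstract group `G` on the complex Hilbert space `V` is a
homomorphism from `G` to the group of unitary operators (surjective linear isometries) of `V`. -/
abbrev UnitaryRep (G : Type*) [Group G] (V : Type*) [NormedAddCommGroup V]
    [InnerProductSpace ℂ V] : Type _ :=
  G →* (V ≃ₗᵢ[ℂ] V)

/-- The subspace `V^H` of vectors invariant under the subgroup `H`. -/
def UnitaryRep.fixedSubspace {G : Type*} [Group G] {V : Type*} [NormedAddCommGroup V]
    [InnerProductSpace ℂ V] (ρ : UnitaryRep G V) (H : Subgroup G) : Submodule ℂ V where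
  carrier := {v | ∀ h ∈ H, ρ h v = v}
  add_mem' := fun {a b} ha hb h hh => by rw [map_add, ha h hh, hb h hh]
  zero_mem' := fun h _ => map_zero (ρ h)
  smul_mem' := fun c v hv h hh => by rw [map_smul, hv h hh]

/-- Two subspaces `U`, `W` of an inner product space are `ε`-orthogonal if
`|⟨u, w⟩| ≤ ε ‖u‖ ‖w‖` for all `u ∈ U` and `w ∈ W`. -/
def SubspacesEpsOrthogonal {V : Type*} [NormedAddCommGroup V] [InnerProductSpace ℂ V]
    (ε : ℝ) (U W : Submodule ℂ V) : Prop :=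
  ∀ u ∈ U, ∀ w ∈ W, ‖inner ℂ u w‖ ≤ ε * ‖u‖ * ‖w‖

universe u v w

/-- Two subgroups `H`, `K` of `G` (with `G = ⟨H, K⟩`) are `ε`-orthogonal if for every unitary
representation `V` of `G` without nonzero `G`-invariant vectors the subspaces `V^H` and `V^K`
are `ε`-orthogonal. -/
def SubgroupsEpsOrthogonal {G : Type u} [Group G] (ε : ℝ) (H K : Subgroup G) : Prop :=
  ∀ (V : Type v) [NormedAddCommGroup V] [InnerProductSpace ℂ V] [CompleteSpace V]
    (ρ : UnitaryRep G V), ρ.fixedSubspace ⊤ = ⊥ →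
      SubspacesEpsOrthogonal ε (ρ.fixedSubspace H) (ρ.fixedSubspace K)

open MulOpposite in
/-- Compatibility axiom of an `A`-group structure: the abelian subgroup `X` is a right `A`-module
(a module over `Aᵐᵒᵖ`), the abelian subgroup `Y` is a left `A`-module (both groups are written
additively as modules), and `[x r, y] = [x, r y]` for all `r ∈ A`, `x ∈ X`, `y ∈ Y`. -/
structure IsAGroup {G : Type*} [Group G] (X Y : Subgroup G)
    [IsMulCommutative X] [IsMulCommutative Y] (A : Type*) [Ring A]
    [Module Aᵐᵒᵖ (Additive X)] [Module A (Additive Y)] : Prop where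
  commutator_smul : ∀ (r : A) (x : X) (y : Y),
    ⁅(((op r • Additive.ofMul x).toMul : X) : G), (y : G)⁆ =
      ⁅(x : G), (((r • Additive.ofMul y).toMul : Y) : G)⁆

/-- An `A`-group is Noetherian if both `X` and `Y` are Noetherian `A`-modules. -/
structure IsNoetherianAGroup {G : Type*} [Group G] (X Y : Subgroup G)
    [IsMulCommutative X] [IsMulCommutative Y] (A : Type*) [Ring A]
    [Module Aᵐᵒᵖ (Additive X)] [Module A (Additive Y)] : Prop extends IsAGroup X Y A where
  noetherian_left : IsNoetherian Aᵐᵒᵖ (Additive X)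
  noetherian_right : IsNoetherian A (Additive Y)

/-- The smallest index of a proper submodule of `M`, as an element of `ℕ∪{∞}`; it is `∞` if there
is no proper submodule of finite index. -/
noncomputable def minProperIndex (R M : Type*) [Ring R] [AddCommGroup M] [Module R M] : ℕ∞ :=
  ⨅ N : {N : Submodule R M // N ≠ ⊤}, ENat.card (M ⧸ N.1)

/-- The number `1/√m` for `m ∈ ℕ ∪ {∞}`, where `1/√∞ = 0`. -/
noncomputable def invSqrt (m : ℕ∞) : ℝ :=
  √((m : ℝ≥0∞)⁻¹.toReal)

/-! Commutators are central, so a character `θ` of the centre turns them into scalars. The elements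
`x` with `θ[x, y] = 1` for all `y` form a subgroup `N` of `X`, and `[xr, y] = [x, ry]` makes it an
`A`-submodule. Suppose that the centre acts on `V` by `θ`. If `N` is proper, it has at least `m`
cosets; translates of a `Y`-fixed `b` by elements of different cosets are orthogonal, and all have
the same inner product with an `X`-fixed `a`. Cauchy–Schwarz against the sum of `n ≤ m` translates
gives `√n |⟨a, b⟩| ≤ ‖a‖ ‖b‖`. If `N = X`, the actions of `X` and `Y` commute, and the absence of
`G`-fixed vectors gives `⟨a, b⟩ = 0`.

In general the centre does not act by scalars. Instead of a direct integral, the proof uses Gelfand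
duality for the centre of the commutant and localises by a partition of unity on its spectrum
(`UnitaryRep.exists_central_calculus`, `IsAGroup.exists_open_sqrt_mul_norm_inner_le`). The vectors
fixed by all commutators `[x, y]` are split off beforehand; on the complement, cut-offs near the
trivial characters contribute arbitrarily little (`exists_open_norm_starHom_apply_le`). -/

/-! ### Gelfand calculus for the centre of the commutant -/

section CentralCalculus

variable {G : Type u} [Group G] {V : Type v} [NormedAddCommGroup V] [InnerProductSpace ℂ V]

/-- The bounded operator by which a group element acts in a unitary representation. -/
noncomputable def UnitaryRep.op (ρ : UnitaryRep G V) (g : G) : V →L[ℂ] V :=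
  ((ρ g).toContinuousLinearEquiv : V →L[ℂ] V)

@[simp]
theorem UnitaryRep.op_apply (ρ : UnitaryRep G V) (g : G) (x : V) : ρ.op g x = ρ g x := rfl

theorem UnitaryRep.mul_apply (ρ : UnitaryRep G V) (g h : G) (x : V) :
    ρ (g * h) x = ρ g (ρ h x) := by
  rw [map_mul]; rfl

theorem UnitaryRep.op_mul (ρ : UnitaryRep G V) (g h : G) : ρ.op (g * h) = ρ.op g * ρ.op h := by
  ext x; exact ρ.mul_apply g h x

theorem UnitaryRep.op_one (ρ : UnitaryRep G V) : ρ.op 1 = 1 := by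
  ext x; simp

theorem UnitaryRep.inv_apply_self (ρ : UnitaryRep G V) (g : G) (x : V) :
    ρ g⁻¹ (ρ g x) = x := by
  rw [← ρ.mul_apply]; simp

theorem UnitaryRep.self_apply_inv (ρ : UnitaryRep G V) (g : G) (x : V) :
    ρ g (ρ g⁻¹ x) = x := by
  rw [← ρ.mul_apply]; simp

theorem UnitaryRep.inner_apply_left (ρ : UnitaryRep G V) (g : G) (x y : V) :
    inner ℂ (ρ g x) y = inner ℂ x (ρ g⁻¹ y) := by
  rw [← (ρ g).inner_map_map x, ρ.self_apply_inv]

variable [CompleteSpace V]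

theorem UnitaryRep.star_op (ρ : UnitaryRep G V) (g : G) : star (ρ.op g) = ρ.op g⁻¹ := by
  rw [ContinuousLinearMap.star_eq_adjoint]
  symm
  rw [ContinuousLinearMap.eq_adjoint_iff]
  intro x y
  rw [ρ.op_apply, ρ.op_apply, ρ.inner_apply_left, inv_inv]

/-- The centre of the commutant of a unitary representation. -/
noncomputable def UnitaryRep.commutantCenter (ρ : UnitaryRep G V) :
    StarSubalgebra ℂ (V →L[ℂ] V) :=
  StarSubalgebra.centralizer ℂ (Set.range ρ.op) ⊓
    StarSubalgebra.centralizer ℂ (StarSubalgebra.centralizer ℂ (Set.range ρ.op) : Set (V →L[ℂ] V))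

theorem UnitaryRep.commutantCenter_comm (ρ : UnitaryRep G V) {a b : V →L[ℂ] V}
    (ha : a ∈ ρ.commutantCenter) (hb : b ∈ ρ.commutantCenter) : a * b = b * a :=
  ((StarSubalgebra.mem_centralizer_iff ℂ).1 hb.2 a ha.1).1

theorem UnitaryRep.op_mem_commutantCenter (ρ : UnitaryRep G V) {z : G}
    (hz : z ∈ Subgroup.center G) : ρ.op z ∈ ρ.commutantCenter := by
  constructor
  · refine (StarSubalgebra.mem_centralizer_iff ℂ).2 ?_
    rintro _ ⟨g, rfl⟩
    rw [ρ.star_op, ← ρ.op_mul, ← ρ.op_mul, ← ρ.op_mul, ← ρ.op_mul]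
    rw [Subgroup.mem_center_iff] at hz
    rw [hz, hz]
    exact ⟨rfl, rfl⟩
  · refine (StarSubalgebra.mem_centralizer_iff ℂ).2 fun a ha => ?_
    have h1 := (StarSubalgebra.mem_centralizer_iff ℂ).1 ha (ρ.op z) ⟨z, rfl⟩
    have h2 := (StarSubalgebra.mem_centralizer_iff ℂ).1 (star_mem ha) (ρ.op z) ⟨z, rfl⟩
    exact ⟨h1.1.symm, h2.1.symm⟩

instance UnitaryRep.isClosed_commutantCenter (ρ : UnitaryRep G V) :
    IsClosed (ρ.commutantCenter : Set (V →L[ℂ] V)) := by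
  have : (ρ.commutantCenter : Set (V →L[ℂ] V)) = _ ∩ _ := rfl
  rw [this, StarSubalgebra.coe_centralizer, StarSubalgebra.coe_centralizer]
  exact (Set.isClosed_centralizer _).inter (Set.isClosed_centralizer _)

noncomputable instance UnitaryRep.commCStarAlgebraCommutantCenter (ρ : UnitaryRep G V) :
    CommCStarAlgebra ρ.commutantCenter where
  mul_comm a b := Subtype.ext (ρ.commutantCenter_comm a.2 b.2)

/-- A functional calculus for the centre of a group acting unitarily: continuous functions on some
compact Hausdorff space act by operators commuting with the group, and central elements of the
group act as continuous functions. -/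
theorem UnitaryRep.exists_central_calculus (ρ : UnitaryRep G V) :
    ∃ (Ω : Type v) (_ : TopologicalSpace Ω) (_ : CompactSpace Ω) (_ : T2Space Ω)
      (Φ : C(Ω, ℂ) →⋆ₐ[ℂ] (V →L[ℂ] V)) (κ : Subgroup.center G →* C(Ω, ℂ)),
      (∀ f g x, Φ f (ρ g x) = ρ g (Φ f x)) ∧ ∀ z x, Φ (κ z) x = ρ (z : G) x := by
  let e := gelfandStarTransform ρ.commutantCenter
  refine ⟨WeakDual.characterSpace ℂ ρ.commutantCenter, inferInstance, inferInstance,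
    inferInstance, ρ.commutantCenter.subtype.comp (e.symm : _ →⋆ₐ[ℂ] ρ.commutantCenter),
    { toFun := fun z => e ⟨ρ.op z, ρ.op_mem_commutantCenter z.2⟩
      map_one' := ?_
      map_mul' := ?_ }, ?_, ?_⟩
  · rw [← map_one e]
    exact congrArg e (Subtype.ext ρ.op_one)
  · intro a b
    rw [← map_mul e]
    exact congrArg e (Subtype.ext (ρ.op_mul _ _))
  · intro f g x
    have h := ((StarSubalgebra.mem_centralizer_iff ℂ).1 (e.symm f).2.1 (ρ.op g) ⟨g, rfl⟩).1
    exact (DFunLike.congr_fun h x).symm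
  · intro z x
    have h := e.symm_apply_apply ⟨ρ.op z, ρ.op_mem_commutantCenter z.2⟩
    exact DFunLike.congr_fun (congrArg Subtype.val h) x

end CentralCalculus

/-! ### Division and partitions of unity for continuous functions -/

section CompactSpace

variable {Ω : Type v} [TopologicalSpace Ω]

/-- The quotient `f / g`, with value `0` where `g` vanishes, is continuous because such points lie
outside the closed support of `f`. -/
theorem ContinuousMap.exists_mul_eq_of_tsupport_subset (f g : C(Ω, ℂ))
    (h : tsupport f ⊆ {x | g x ≠ 0}) : ∃ k : C(Ω, ℂ), g * k = f := by
  refine ⟨⟨fun x => f x / g x, ?_⟩, ?_⟩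
  · refine continuous_of_tsupport fun x hx => ?_
    have hx' : x ∈ tsupport f := by
      refine closure_mono ?_ hx
      intro y hy
      simp only [Function.mem_support] at hy ⊢
      exact fun h0 => hy (by simp [h0])
    exact f.continuous.continuousAt.div g.continuous.continuousAt (h hx')
  · ext x
    by_cases hx : g x = 0
    · have : f x = 0 := by
        by_contra h0
        exact h (subset_tsupport f h0) hx
      simp [hx, this]
    · simp [mul_div_cancel₀, hx]

/-- A finite partition of unity by squares subordinate to an open cover of a compact Hausdorff
space. -/
theorem exists_sum_star_mul_self_eq_one [CompactSpace Ω] [T2Space Ω] {ι : Type*} (U : ι → Set Ω)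
    (hU : ∀ i, IsOpen (U i)) (hcov : ∀ x, ∃ i, x ∈ U i) :
    ∃ (s : Finset ι) (h : ι → C(Ω, ℂ)), ∑ i ∈ s, star (h i) * h i = 1 ∧
      (∀ i, tsupport (h i) ⊆ U i) ∧ ∀ i, ‖h i‖ ≤ 1 := by
  obtain ⟨f, hf⟩ := PartitionOfUnity.exists_isSubordinate (s := (Set.univ : Set Ω))
    isClosed_univ U hU (fun x _ => Set.mem_iUnion.2 (hcov x))
  have hfin : Set.Finite {i | (Function.support (f i)).Nonempty} :=
    f.locallyFinite.finite_nonempty_of_compact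
  refine ⟨hfin.toFinset, fun i => ⟨fun x => ((√(f i x) : ℝ) : ℂ), by fun_prop⟩, ?_, ?_, ?_⟩
  · ext x
    have h1 := f.sum_eq_one (Set.mem_univ x)
    rw [finsum_eq_sum_of_support_subset (s := hfin.toFinset)] at h1
    · simp only [ContinuousMap.sum_apply, ContinuousMap.mul_apply, ContinuousMap.star_apply,
        ContinuousMap.coe_mk, ContinuousMap.one_apply, RCLike.star_def, Complex.conj_ofReal]
      rw [← Complex.ofReal_one, ← h1, Complex.ofReal_sum]
      refine Finset.sum_congr rfl fun i _ => ?_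
      rw [← Complex.ofReal_mul, Real.mul_self_sqrt (f.nonneg i x)]
    · intro i hi
      simp only [Set.Finite.coe_toFinset, Set.mem_ofPred_eq]
      exact ⟨x, hi⟩
  · intro i
    refine Set.Subset.trans (closure_mono ?_) (hf i)
    intro x hx
    simp only [Function.mem_support, ContinuousMap.coe_mk] at hx ⊢
    exact fun h0 => hx (by simp [h0])
  · intro i
    refine (ContinuousMap.norm_le _ zero_le_one).2 fun x => ?_
    simp only [ContinuousMap.coe_mk, Complex.norm_real, Real.norm_eq_abs,
      abs_of_nonneg (Real.sqrt_nonneg _)]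
    exact Real.sqrt_le_one.2 (f.le_one i x)

end CompactSpace

/-- Cauchy–Schwarz for `a` and `∑ v i`: the inner product is `n⟨a, b⟩`, while by Pythagoras the sum
has norm only `√n ‖b‖`. -/
theorem sqrt_mul_norm_inner_le_of_orthogonal {V : Type*} [NormedAddCommGroup V]
    [InnerProductSpace ℂ V] {n : ℕ} (v : Fin n → V) (a b : V)
    (horth : ∀ i j, i ≠ j → inner ℂ (v i) (v j) = 0) (hnorm : ∀ i, ‖v i‖ = ‖b‖)
    (hinner : ∀ i, inner ℂ a (v i) = inner ℂ a b) :
    √n * ‖inner ℂ a b‖ ≤ ‖a‖ * ‖b‖ := by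
  have h1 : inner ℂ a (∑ i, v i) = n * inner ℂ a b := by
    rw [inner_sum]; simp [hinner]
  have h2 : ‖∑ i, v i‖ ^ 2 = n * ‖b‖ ^ 2 := by
    have : ((‖∑ i, v i‖ ^ 2 : ℝ) : ℂ) = ((n * ‖b‖ ^ 2 : ℝ) : ℂ) := by
      push_cast
      rw [← Complex.coe_algebraMap, ← inner_self_eq_norm_sq_to_K, sum_inner]
      have : ∀ i, inner ℂ (v i) (∑ j, v j) = (‖b‖ : ℂ) ^ 2 := by
        intro i
        rw [inner_sum, Finset.sum_eq_single i (fun j _ hj => horth i j hj.symm) (by simp),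
          inner_self_eq_norm_sq_to_K, hnorm]
        rfl
      simp [this]
    exact_mod_cast this
  have h3 : ‖∑ i, v i‖ = √n * ‖b‖ := by
    rw [← Real.sqrt_sq (norm_nonneg (∑ i, v i)), h2, Real.sqrt_mul (by positivity),
      Real.sqrt_sq (norm_nonneg b)]
  have h4 := norm_inner_le_norm (𝕜 := ℂ) a (∑ i, v i)
  rw [h1, h3, norm_mul, Complex.norm_natCast] at h4
  rcases Nat.eq_zero_or_pos n with rfl | hn
  · simp; positivity
  · have hs : 0 < √(n : ℝ) := Real.sqrt_pos.2 (by exact_mod_cast hn)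
    refine le_of_mul_le_mul_left ?_ hs
    rw [← mul_assoc, Real.mul_self_sqrt (by positivity)]
    linarith

/-! ### Localising vectors by cut-off functions -/

section StarHom

variable {V : Type v} [NormedAddCommGroup V] [InnerProductSpace ℂ V] [CompleteSpace V]
  {Ω : Type v} [TopologicalSpace Ω] (Φ : C(Ω, ℂ) →⋆ₐ[ℂ] (V →L[ℂ] V))

theorem inner_starHom_apply (f g : C(Ω, ℂ)) (a b : V) :
    inner ℂ (Φ f a) (Φ g b) = inner ℂ a (Φ (star f * g) b) := by
  rw [map_mul, map_star, ContinuousLinearMap.star_eq_adjoint]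
  exact (ContinuousLinearMap.adjoint_inner_right _ _ _).symm

theorem sum_inner_starHom_apply {ι : Type*} (s : Finset ι) (h : ι → C(Ω, ℂ))
    (hs : ∑ i ∈ s, star (h i) * h i = 1) (a b : V) :
    ∑ i ∈ s, inner ℂ (Φ (h i) a) (Φ (h i) b) = inner ℂ a b := by
  simp_rw [inner_starHom_apply]
  rw [← inner_sum, ← sum_apply, ← map_sum, hs, map_one]
  rfl

theorem sum_norm_sq_starHom_apply {ι : Type*} (s : Finset ι) (h : ι → C(Ω, ℂ))
    (hs : ∑ i ∈ s, star (h i) * h i = 1) (a : V) :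
    ∑ i ∈ s, ‖Φ (h i) a‖ ^ 2 = ‖a‖ ^ 2 := by
  have := sum_inner_starHom_apply Φ s h hs a a
  simp_rw [inner_self_eq_norm_sq_to_K] at this
  exact_mod_cast this

variable [CompactSpace Ω]

theorem norm_starHom_apply_le (f : C(Ω, ℂ)) (a : V) : ‖Φ f a‖ ≤ ‖f‖ * ‖a‖ :=
  (ContinuousLinearMap.le_opNorm _ _).trans
    (mul_le_mul_of_nonneg_right (NonUnitalStarAlgHom.norm_apply_le Φ f) (norm_nonneg a))

/-- A vector in the closed span of the vectors `z v - v` becomes small when multiplied by a cut-off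
function concentrated near the characters which are trivial on all `z`. -/
theorem exists_open_norm_starHom_apply_le {I : Type*} (c : I → C(Ω, ℂ)) (a : V)
    (ha : a ∈ (Submodule.span ℂ
      {b | ∃ i x, b = Φ (c i) x - x}).topologicalClosure) {δ : ℝ} (hδ : 0 < δ) :
    ∃ U : Set Ω, IsOpen U ∧ {χ | ∀ i, c i χ = 1} ⊆ U ∧
      ∀ h : C(Ω, ℂ), tsupport h ⊆ U → ‖h‖ ≤ 1 → ‖Φ h a‖ ≤ δ := by
  have key : ∀ b ∈ Submodule.span ℂ {b | ∃ i x, b = Φ (c i) x - x}, ∀ δ : ℝ, 0 < δ →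
      ∃ U : Set Ω, IsOpen U ∧ {χ | ∀ i, c i χ = 1} ⊆ U ∧
      ∀ h : C(Ω, ℂ), tsupport h ⊆ U → ‖h‖ ≤ 1 → ‖Φ h b‖ ≤ δ := by
    intro b hb
    induction hb using Submodule.span_induction with
    | mem b hb =>
      obtain ⟨i, x, rfl⟩ := hb
      intro δ hδ
      refine ⟨{χ | ‖c i χ - 1‖ * ‖x‖ < δ}, ?_, ?_, ?_⟩
      · exact isOpen_lt (by fun_prop) continuous_const
      · intro χ hχ
        simp only [Set.mem_ofPred_eq] at hχ ⊢
        simpa [hχ i] using hδ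
      · intro h hU h1
        -- Moving `‖x‖` into the function leaves a vector of norm at most `1`, so only a sup norm
        -- remains to be bounded.
        have e : Φ h (Φ (c i) x - x) = Φ (((‖x‖ : ℝ) : ℂ) • (h * (c i - 1))) ((‖x‖⁻¹ : ℂ) • x) := by
          by_cases hx : x = 0
          · simp [hx]
          · have : (‖x‖ : ℂ) ≠ 0 := by simpa using hx
            have h2 : Φ (h * (c i - 1)) = Φ h * (Φ (c i) - 1) := by
              rw [map_mul, map_sub, map_one Φ]
            rw [map_smul, map_smul, smul_apply, smul_smul, inv_mul_cancel₀ this, one_smul, h2]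
            simp
        rw [e]
        refine (norm_starHom_apply_le Φ _ _).trans ?_
        have hn : ‖(‖x‖⁻¹ : ℂ) • x‖ ≤ 1 := by
          rw [norm_smul, norm_inv, Complex.norm_real, norm_norm]
          exact inv_mul_le_one
        refine (mul_le_of_le_one_right (norm_nonneg _) hn).trans ?_
        refine (ContinuousMap.norm_le _ hδ.le).2 fun χ => ?_
        by_cases hχ : h χ = 0
        · simp [hχ, hδ.le]
        · have h2 : ‖c i χ - 1‖ * ‖x‖ < δ := hU (subset_tsupport h hχ)
          have h3 : ‖h χ‖ ≤ 1 := (h.norm_coe_le_norm χ).trans h1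
          simp only [ContinuousMap.smul_apply, ContinuousMap.mul_apply, ContinuousMap.sub_apply,
            ContinuousMap.one_apply, smul_eq_mul, norm_mul, Complex.norm_real, norm_norm]
          calc ‖x‖ * (‖h χ‖ * ‖c i χ - 1‖) = ‖h χ‖ * (‖c i χ - 1‖ * ‖x‖) := by ring
            _ ≤ 1 * (‖c i χ - 1‖ * ‖x‖) := by gcongr
            _ ≤ δ := by linarith
    | zero => exact fun δ hδ => ⟨Set.univ, isOpen_univ, Set.subset_univ _, by simp [hδ.le]⟩
    | add b b' _ _ ih ih' =>
      intro δ hδ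
      obtain ⟨U, hU, hF, h1⟩ := ih (δ / 2) (by positivity)
      obtain ⟨U', hU', hF', h1'⟩ := ih' (δ / 2) (by positivity)
      refine ⟨U ∩ U', hU.inter hU', Set.subset_inter hF hF', fun h hs hn => ?_⟩
      rw [map_add]
      have := h1 h (hs.trans Set.inter_subset_left) hn
      have := h1' h (hs.trans Set.inter_subset_right) hn
      exact (norm_add_le _ _).trans (by linarith)
    | smul r b _ ih =>
      intro δ hδ
      obtain ⟨U, hU, hF, h1⟩ := ih (δ / (‖r‖ + 1)) (by positivity)
      refine ⟨U, hU, hF, fun h hs hn => ?_⟩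
      rw [map_smul, norm_smul]
      calc ‖r‖ * ‖Φ h b‖ ≤ (‖r‖ + 1) * (δ / (‖r‖ + 1)) := by
            gcongr
            · linarith
            · exact h1 h hs hn
        _ = δ := by field_simp
  obtain ⟨b, hb, hab⟩ := Metric.mem_closure_iff.1 ha (δ / 2) (by positivity)
  obtain ⟨U, hU, hF, h1⟩ := key b hb (δ / 2) (by positivity)
  refine ⟨U, hU, hF, fun h hs hn => ?_⟩
  have h2 := h1 h hs hn
  have h3 : ‖Φ h (a - b)‖ ≤ δ / 2 := by
    refine (norm_starHom_apply_le Φ _ _).trans ?_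
    rw [dist_eq_norm] at hab
    calc ‖h‖ * ‖a - b‖ ≤ 1 * ‖a - b‖ := by gcongr
      _ ≤ δ / 2 := by linarith
  calc ‖Φ h a‖ = ‖Φ h (a - b) + Φ h b‖ := by rw [← map_add, sub_add_cancel]
    _ ≤ δ := (norm_add_le _ _).trans (by linarith)

end StarHom

/-! ### Central commutators and the submodule killed by a character -/

section CentralCommutators

variable {G : Type u} [Group G]

theorem commutatorElement_mem_center_of_nilpotencyClass_le_two [Group.IsNilpotent G]
    (hG : Group.nilpotencyClass G ≤ 2) (g h : G) : ⁅g, h⁆ ∈ Subgroup.center G := by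
  have h2 := Subgroup.upperCentralSeries_eq_top_iff_nilpotencyClass_le.2 hG
  have hg : g ∈ Subgroup.upperCentralSeries G 2 := by rw [h2]; trivial
  have := (Subgroup.mem_upperCentralSeries_succ_iff).1 hg h
  rwa [Subgroup.upperCentralSeries_one] at this

theorem commutatorElement_mul_left_of_mem_center {a b y : G}
    (h : ⁅b, y⁆ ∈ Subgroup.center G) : ⁅a * b, y⁆ = ⁅a, y⁆ * ⁅b, y⁆ := by
  have : ⁅a * b, y⁆ = a * ⁅b, y⁆ * a⁻¹ * ⁅a, y⁆ := by
    simp only [commutatorElement_def]; group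
  rw [this, Subgroup.mem_center_iff.1 h a, mul_inv_cancel_right, Subgroup.mem_center_iff.1 h]

/-- The `A`-submodule of `X` of all elements whose commutators with `Y` are killed by a character of
the centre. -/
def IsAGroup.commutatorKernel {X Y : Subgroup G} [IsMulCommutative X] [IsMulCommutative Y]
    {A : Type w} [Ring A] [Module Aᵐᵒᵖ (Additive X)] [Module A (Additive Y)]
    (hA : IsAGroup X Y A) (hc : ∀ g h : G, ⁅g, h⁆ ∈ Subgroup.center G)
    (θ : Subgroup.center G →* ℂ) : Submodule Aᵐᵒᵖ (Additive X) where
  carrier := {x | ∀ y : Y, θ ⟨⁅((x.toMul : X) : G), (y : G)⁆, hc _ _⟩ = 1}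
  zero_mem' := fun y => by
    rw [← map_one θ]
    exact congrArg θ (Subtype.ext (by simp))
  add_mem' := fun {a b} ha hb y => by
    have h := congrArg θ (Subtype.ext (commutatorElement_mul_left_of_mem_center
      (hc ((b.toMul : X) : G) y) (a := ((a.toMul : X) : G))) :
        (⟨⁅((a.toMul : X) : G) * (b.toMul : X), (y : G)⁆, hc _ _⟩ : Subgroup.center G) =
          ⟨⁅((a.toMul : X) : G), (y : G)⁆, hc _ _⟩ * ⟨⁅((b.toMul : X) : G), (y : G)⁆, hc _ _⟩)
    rw [map_mul, ha y, hb y, one_mul] at h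
    exact h
  smul_mem' := fun r x hx y => by
    -- The scalar moves across the commutator to `y`, and the condition on `x` covers all of `Y`.
    rw [← hx (r.unop • Additive.ofMul y).toMul]
    exact congrArg θ (Subtype.ext (hA.commutator_smul r.unop x.toMul y))

theorem exists_injective_fin_of_le_card {α : Type*} {n : ℕ} (h : (n : ℕ∞) ≤ ENat.card α) :
    ∃ f : Fin n → α, Function.Injective f := by
  rw [ENat.card, Cardinal.natCast_le_toENat] at h
  have hf : Nonempty (Fin n ↪ α) := Cardinal.lift_mk_le'.1 (by simpa using h)
  exact hf.elim fun f => ⟨f, f.injective⟩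

theorem exists_fin_sub_notMem_of_le_minProperIndex {R M : Type*} [Ring R] [AddCommGroup M]
    [Module R M] {n : ℕ} (hn : (n : ℕ∞) ≤ minProperIndex R M) (N : Submodule R M) (hN : N ≠ ⊤) :
    ∃ x : Fin n → M, ∀ i j, i ≠ j → -x i + x j ∉ N := by
  obtain ⟨f, hf⟩ := exists_injective_fin_of_le_card (hn.trans (iInf_le _ ⟨N, hN⟩))
  refine ⟨fun i => (f i).out, fun i j hij h => hij (hf ?_)⟩
  rw [← Quotient.out_eq (f i), ← Quotient.out_eq (f j)]
  exact (Submodule.Quotient.eq' N).2 h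

end CentralCommutators

/-! ### Fixed subspaces and invariant projections -/

section Representation

variable {G : Type u} [Group G] {V : Type v} [NormedAddCommGroup V] [InnerProductSpace ℂ V]
  (ρ : UnitaryRep G V)

theorem UnitaryRep.isClosed_fixedSubspace (H : Subgroup G) :
    IsClosed (ρ.fixedSubspace H : Set V) := by
  have : (ρ.fixedSubspace H : Set V) = ⋂ h ∈ H, {x | ρ h x = x} := by
    ext x; simp [UnitaryRep.fixedSubspace]
  rw [this]
  exact isClosed_biInter fun h _ => isClosed_eq (ρ h).continuous continuous_id

theorem UnitaryRep.mem_fixedSubspace_sup {H K : Subgroup G} {x : V} (hH : x ∈ ρ.fixedSubspace H)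
    (hK : x ∈ ρ.fixedSubspace K) : x ∈ ρ.fixedSubspace (H ⊔ K) := by
  let S : Subgroup G :=
    { carrier := {g | ρ g x = x}
      one_mem' := by simp
      mul_mem' := fun {a b} ha hb => by
        simp only [Set.mem_ofPred_eq] at ha hb ⊢
        rw [ρ.mul_apply, hb, ha]
      inv_mem' := fun {a} ha => by
        simp only [Set.mem_ofPred_eq] at ha ⊢
        nth_rw 1 [← ha]
        exact ρ.inv_apply_self a x }
  exact (sup_le (fun h hh => hH h hh) (fun h hh => hK h hh) : H ⊔ K ≤ S)

/-- The orthogonal projection onto an invariant closed subspace commutes with the group. -/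
theorem UnitaryRep.apply_starProjection (g : G) (S : Submodule ℂ V) [S.HasOrthogonalProjection]
    (h : ∀ x ∈ S, ρ g x ∈ S) (h' : ∀ x ∈ S, ρ g⁻¹ x ∈ S) (x : V) :
    ρ g (S.starProjection x) = S.starProjection (ρ g x) := by
  symm
  refine Submodule.eq_starProjection_of_mem_of_inner_eq_zero
    (h _ (Submodule.starProjection_apply_mem S x)) fun y hy => ?_
  rw [← map_sub, ρ.inner_apply_left]
  exact Submodule.starProjection_inner_eq_zero x _ (h' y hy)

variable [CompleteSpace V]

/-- A closed `K`-invariant subspace without nonzero `K`-fixed vectors is orthogonal to `V^K`. -/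
theorem UnitaryRep.inner_eq_zero_of_invariant (S : Submodule ℂ V) (hS : IsClosed (S : Set V))
    (K : Subgroup G) (hK : ∀ k ∈ K, ∀ x ∈ S, ρ k x ∈ S)
    (h0 : ∀ x ∈ S, x ∈ ρ.fixedSubspace K → x = 0) {a b : V} (ha : a ∈ S)
    (hb : b ∈ ρ.fixedSubspace K) : inner ℂ a b = 0 := by
  have := hS.completeSpace_coe
  have h1 : S.starProjection b = 0 := by
    refine h0 _ (Submodule.starProjection_apply_mem S b) fun k hk => ?_
    rw [ρ.apply_starProjection k S (hK k hk) (hK _ (inv_mem hk)), hb k hk]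
  have h2 := Submodule.starProjection_inner_eq_zero b a ha (K := S)
  rw [h1, sub_zero] at h2
  rw [← inner_conj_symm, h2, map_zero]

end Representation

/-! ### The estimate near a character nontrivial on commutators -/

section LocalEstimate

variable {G : Type u} [Group G] {V : Type v} [NormedAddCommGroup V] [InnerProductSpace ℂ V]
  [CompleteSpace V] {ρ : UnitaryRep G V} {Ω : Type v} [TopologicalSpace Ω]
  {Φ : C(Ω, ℂ) →⋆ₐ[ℂ] (V →L[ℂ] V)} {κ : Subgroup.center G →* C(Ω, ℂ)}

/-- Applying `y` to both arguments of `⟨tb, Φ k b⟩` multiplies `k` by the function of `[t, y]`.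
Hence `⟨tb, Φ f b⟩ = 0` for every multiple `f` of `1 - κ[t, y]`, and the support condition makes
`star h * h` such a multiple. -/
theorem inner_apply_starHom_eq_zero (hΦ : ∀ f g x, Φ f (ρ g x) = ρ g (Φ f x))
    (hκ : ∀ z x, Φ (κ z) x = ρ (z : G) x) {t y : G} (hc : ⁅t, y⁆ ∈ Subgroup.center G) {b : V}
    (hb : ρ y b = b) (h : C(Ω, ℂ)) (hsupp : tsupport h ⊆ {χ | κ ⟨⁅t, y⁆, hc⟩ χ ≠ 1}) :
    inner ℂ (ρ t (Φ h b)) (Φ h b) = 0 := by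
  have h1 : ∀ k : C(Ω, ℂ), inner ℂ (ρ t b) (Φ k b) =
      inner ℂ (ρ t b) (Φ (κ ⟨⁅t, y⁆, hc⟩ * k) b) := by
    intro k
    have e1 : ρ y (ρ t b) = ρ ⁅t, y⁆⁻¹ (ρ t b) := by
      nth_rw 2 [← hb]
      rw [← ρ.mul_apply, ← ρ.mul_apply, ← ρ.mul_apply]
      congr 2
      simp only [commutatorElement_def]; group
    rw [map_mul]
    change _ = inner ℂ (ρ t b) (Φ (κ ⟨⁅t, y⁆, hc⟩) (Φ k b))
    rw [hκ, ← (ρ y).inner_map_map, e1, ← hΦ, hb, ρ.inner_apply_left, inv_inv]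
  obtain ⟨k, hk⟩ := ContinuousMap.exists_mul_eq_of_tsupport_subset (star h * h)
    (1 - κ ⟨⁅t, y⁆, hc⟩) (by
      refine (closure_mono ?_).trans (hsupp.trans ?_)
      · intro χ hχ h0
        exact hχ (by simp [h0])
      · intro χ hχ h0
        exact hχ (sub_eq_zero.1 h0).symm)
  rw [← hΦ, inner_starHom_apply, ← hk, sub_mul, one_mul, map_sub, sub_apply,
    inner_sub_right, ← h1, sub_self]

/-- Near a character of the centre whose commutator kernel has at least `n` cosets in `X`, the
spaces `V^X` and `V^Y` are `1 / √n`-orthogonal. -/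
theorem IsAGroup.exists_open_sqrt_mul_norm_inner_le {X Y : Subgroup G} [IsMulCommutative X]
    [IsMulCommutative Y] {A : Type w} [Ring A] [Module Aᵐᵒᵖ (Additive X)] [Module A (Additive Y)]
    (hA : IsAGroup X Y A) (hc : ∀ g h : G, ⁅g, h⁆ ∈ Subgroup.center G)
    (hΦ : ∀ f g x, Φ f (ρ g x) = ρ g (Φ f x)) (hκ : ∀ z x, Φ (κ z) x = ρ (z : G) x)
    {n : ℕ} (hn : (n : ℕ∞) ≤ minProperIndex Aᵐᵒᵖ (Additive X)) {a b : V}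
    (ha : a ∈ ρ.fixedSubspace X) (hb : b ∈ ρ.fixedSubspace Y) (χ : Ω)
    (hχ : ∃ p : X × Y, κ ⟨⁅(p.1 : G), (p.2 : G)⁆, hc _ _⟩ χ ≠ 1) :
    ∃ U : Set Ω, IsOpen U ∧ χ ∈ U ∧ ∀ h : C(Ω, ℂ), tsupport h ⊆ U →
      √n * ‖inner ℂ (Φ h a) (Φ h b)‖ ≤ ‖Φ h a‖ * ‖Φ h b‖ := by
  let θ : Subgroup.center G →* ℂ :=
    { toFun := fun z => κ z χ, map_one' := by simp, map_mul' := by simp }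
  have hN : hA.commutatorKernel hc θ ≠ ⊤ := by
    intro htop
    obtain ⟨⟨x, y⟩, hxy⟩ := hχ
    have : Additive.ofMul x ∈ hA.commutatorKernel hc θ := by rw [htop]; trivial
    exact hxy (this y)
  obtain ⟨x, hx⟩ := exists_fin_sub_notMem_of_le_minProperIndex hn _ hN
  have hy : ∀ i j, ∃ y : Y, i ≠ j →
      κ ⟨⁅((-x i + x j).toMul : G), (y : G)⁆, hc _ _⟩ χ ≠ 1 := by
    intro i j
    by_cases hij : i = j
    · exact ⟨1, fun h => absurd hij h⟩
    · have := hx i j hij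
      obtain ⟨y, hy⟩ := not_forall.1 this
      exact ⟨y, fun _ => hy⟩
  choose y hy using hy
  refine ⟨⋂ i, ⋂ j, {ψ | i ≠ j →
    κ ⟨⁅((-x i + x j).toMul : G), (y i j : G)⁆, hc _ _⟩ ψ ≠ 1}, ?_, ?_, ?_⟩
  · refine isOpen_iInter_of_finite fun i => isOpen_iInter_of_finite fun j => ?_
    by_cases hij : i = j
    · simp [hij]
    · simpa [hij] using isOpen_ne_fun (ContinuousMap.continuous _) continuous_const
  · exact Set.mem_iInter.2 fun i => Set.mem_iInter.2 fun j => hy i j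
  · intro h hU
    refine sqrt_mul_norm_inner_le_of_orthogonal (fun i => ρ ((x i).toMul : X) (Φ h b)) _ _
      ?_ (fun i => LinearIsometryEquiv.norm_map _ _) ?_
    · intro i j hij
      -- The product becomes `⟨ρ(xⱼ⁻¹xᵢ)v, v⟩` with `v = Φ h b`, hence the reversed indices in `y j
      -- i`.
      rw [← inv_inv (((x j).toMul : X) : G), ← ρ.inner_apply_left, ← ρ.mul_apply]
      refine inner_apply_starHom_eq_zero hΦ hκ (hc _ (y j i)) (hb _ (y j i).2) h (fun ψ hψ => ?_)
      exact Set.mem_iInter.1 (Set.mem_iInter.1 (hU hψ) j) i hij.symm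
    · intro i
      rw [← inv_inv (((x i).toMul : X) : G), ← ρ.inner_apply_left, ← hΦ,
        ha _ (inv_mem (x i).toMul.2)]

end LocalEstimate

/-! ### Gluing the local estimates and splitting off the trivial part -/

section GlobalEstimate

variable {G : Type u} [Group G] {V : Type v} [NormedAddCommGroup V] [InnerProductSpace ℂ V]
  [CompleteSpace V] (ρ : UnitaryRep G V)
  {X Y : Subgroup G} [IsMulCommutative X] [IsMulCommutative Y] {A : Type w} [Ring A]
  [Module Aᵐᵒᵖ (Additive X)] [Module A (Additive Y)]

/-- The estimate on the closed span of the vectors `⁅x, y⁆ v - v`. -/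
theorem IsAGroup.sqrt_mul_norm_inner_le_of_mem_closure (hA : IsAGroup X Y A)
    (hc : ∀ g h : G, ⁅g, h⁆ ∈ Subgroup.center G)
    {n : ℕ} (hn : (n : ℕ∞) ≤ minProperIndex Aᵐᵒᵖ (Additive X)) {a b : V}
    (ha : a ∈ ρ.fixedSubspace X) (hb : b ∈ ρ.fixedSubspace Y)
    (hb' : b ∈ (Submodule.span ℂ {c | ∃ (p : X × Y) (d : V),
      c = ρ ⁅(p.1 : G), (p.2 : G)⁆ d - d}).topologicalClosure) :
    √n * ‖inner ℂ a b‖ ≤ ‖a‖ * ‖b‖ := by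
  obtain ⟨Ω, _, _, _, Φ, κ, hΦ, hκ⟩ := ρ.exists_central_calculus
  let c : X × Y → C(Ω, ℂ) := fun p => κ ⟨⁅(p.1 : G), (p.2 : G)⁆, hc _ _⟩
  have hb'' : b ∈ (Submodule.span ℂ {e | ∃ p d, e = Φ (c p) d - d}).topologicalClosure := by
    simpa only [c, hκ] using hb'
  have key : ∀ δ : ℝ, 0 < δ → √n * ‖inner ℂ a b‖ ≤ ‖a‖ * ‖b‖ + √n * (‖a‖ * δ) := by
    intro δ hδ
    obtain ⟨U₀, hU₀, hF, hsmall⟩ := exists_open_norm_starHom_apply_le Φ c b hb'' hδ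
    have hloc := fun χ : {χ : Ω // ∃ p, c p χ ≠ 1} =>
      hA.exists_open_sqrt_mul_norm_inner_le hc hΦ hκ hn ha hb χ.1 χ.2
    choose U hUo hUmem hU using hloc
    -- The index `none` carries the neighbourhood of the characters trivial on all commutators;
    -- every other character has its own `some` index.
    obtain ⟨s, h, hsum, hsupp, hnorm⟩ := exists_sum_star_mul_self_eq_one
      (fun i : Option {χ : Ω // ∃ p, c p χ ≠ 1} => i.elim U₀ U)
      (by rintro (_ | i); exacts [hU₀, hUo i])
      (fun χ => by
        by_cases hχ : ∃ p, c p χ ≠ 1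
        · exact ⟨some ⟨χ, hχ⟩, hUmem _⟩
        · exact ⟨none, hF fun p => not_not.1 fun hp => hχ ⟨p, hp⟩⟩)
    have hterm : ∀ i, √n * ‖inner ℂ (Φ (h i) a) (Φ (h i) b)‖ ≤
        ‖Φ (h i) a‖ * ‖Φ (h i) b‖ + if i = none then √n * (‖a‖ * δ) else 0 := by
      rintro (_ | i)
      · have h1 := hsmall (h none) (hsupp none) (hnorm none)
        have h2 : ‖Φ (h none) a‖ ≤ ‖a‖ := (norm_starHom_apply_le Φ _ _).trans
          (mul_le_of_le_one_left (norm_nonneg a) (hnorm none))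
        have h3 : √n * ‖inner ℂ (Φ (h none) a) (Φ (h none) b)‖ ≤ √n * (‖a‖ * δ) := by
          gcongr
          exact (norm_inner_le_norm _ _).trans (by gcongr)
        rw [if_pos rfl]
        have : 0 ≤ ‖Φ (h none) a‖ * ‖Φ (h none) b‖ := by positivity
        linarith
      · simpa using hU i (h (some i)) (hsupp (some i))
    have hcs : ∑ i ∈ s, ‖Φ (h i) a‖ * ‖Φ (h i) b‖ ≤ ‖a‖ * ‖b‖ := by
      have := Real.sum_mul_le_sqrt_mul_sqrt s (fun i => ‖Φ (h i) a‖) (fun i => ‖Φ (h i) b‖)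
      rwa [sum_norm_sq_starHom_apply Φ s h hsum, sum_norm_sq_starHom_apply Φ s h hsum,
        Real.sqrt_sq (norm_nonneg a), Real.sqrt_sq (norm_nonneg b)] at this
    have hrest : (∑ i ∈ s, if i = none then √n * (‖a‖ * δ) else 0) ≤ √n * (‖a‖ * δ) := by
      classical
      have h1 := Finset.sum_ite_eq' s none fun _ => √n * (‖a‖ * δ)
      calc _ = if none ∈ s then √n * (‖a‖ * δ) else 0 := by convert! h1
        _ ≤ √n * (‖a‖ * δ) := by
          split_ifs
          · exact le_rfl
          · positivity
    calc √n * ‖inner ℂ a b‖ ≤ √n * ∑ i ∈ s, ‖inner ℂ (Φ (h i) a) (Φ (h i) b)‖ := by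
          rw [← sum_inner_starHom_apply Φ s h hsum]
          gcongr
          exact norm_sum_le _ _
      _ ≤ ∑ i ∈ s, (‖Φ (h i) a‖ * ‖Φ (h i) b‖ + if i = none then √n * (‖a‖ * δ) else 0) := by
          rw [Finset.mul_sum]
          exact Finset.sum_le_sum fun i _ => hterm i
      _ ≤ ‖a‖ * ‖b‖ + √n * (‖a‖ * δ) := by
          rw [Finset.sum_add_distrib]
          exact add_le_add hcs hrest
  refine le_of_forall_pos_le_add fun ε hε => ?_
  -- The `+ 1` keeps the denominator positive when `√n * ‖a‖ = 0`.
  refine (key (ε / (√n * ‖a‖ + 1)) (by positivity)).trans ?_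
  gcongr
  rw [← mul_assoc, ← mul_div_assoc, div_le_iff₀ (by positivity)]
  nlinarith

theorem IsAGroup.sqrt_mul_norm_inner_le (hA : IsAGroup X Y A)
    (hc : ∀ g h : G, ⁅g, h⁆ ∈ Subgroup.center G) (hXY : X ⊔ Y = ⊤)
    (hρ : ρ.fixedSubspace ⊤ = ⊥)
    {n : ℕ} (hn : (n : ℕ∞) ≤ minProperIndex Aᵐᵒᵖ (Additive X)) {a b : V}
    (ha : a ∈ ρ.fixedSubspace X) (hb : b ∈ ρ.fixedSubspace Y) :
    √n * ‖inner ℂ a b‖ ≤ ‖a‖ * ‖b‖ := by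
  let Z : Subgroup G := Subgroup.closure {z | ∃ p : X × Y, z = ⁅(p.1 : G), (p.2 : G)⁆}
  have hZ : Z ≤ Subgroup.center G := by
    refine (Subgroup.closure_le _).2 ?_
    rintro _ ⟨p, rfl⟩
    exact hc _ _
  let S := ρ.fixedSubspace Z
  have hS : IsClosed (S : Set V) := ρ.isClosed_fixedSubspace Z
  have := hS.completeSpace_coe
  have hinv : ∀ g, ∀ x ∈ S, ρ g x ∈ S := by
    intro g x hx z hz
    rw [← ρ.mul_apply, ← Subgroup.mem_center_iff.1 (hZ hz) g, ρ.mul_apply, hx z hz]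
  have hproj : ∀ (H : Subgroup G) (x : V), x ∈ ρ.fixedSubspace H →
      S.starProjection x ∈ ρ.fixedSubspace H := by
    intro H x hx k hk
    rw [ρ.apply_starProjection k S (hinv k) (hinv _), hx k hk]
  let a₀ := S.starProjection a
  let b₀ := S.starProjection b
  -- On `S` the actions of `X` and `Y` commute, so `V^X ∩ S` is `Y`-invariant; a `Y`-fixed vector in
  -- it is fixed by `G`, hence zero.
  have h0 : inner ℂ a₀ b₀ = 0 := by
    refine ρ.inner_eq_zero_of_invariant (ρ.fixedSubspace X ⊓ S)
      ((ρ.isClosed_fixedSubspace X).inter hS) Y ?_ ?_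
      ⟨hproj X a ha, Submodule.starProjection_apply_mem S a⟩ (hproj Y b hb)
    · rintro y hy v ⟨hvX, hvS⟩
      refine ⟨fun x hx => ?_, hinv y v hvS⟩
      have e : x * y = y * x * ⁅x⁻¹, y⁻¹⁆ := by
        simp only [commutatorElement_def]; group
      rw [← ρ.mul_apply, e, ρ.mul_apply, hvS, ρ.mul_apply, hvX x hx]
      exact Subgroup.subset_closure ⟨(⟨x⁻¹, inv_mem hx⟩, ⟨y⁻¹, inv_mem hy⟩), rfl⟩
    · rintro v ⟨hvX, -⟩ hvY
      have := ρ.mem_fixedSubspace_sup hvX hvY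
      rw [hXY, hρ] at this
      exact (Submodule.mem_bot ℂ).1 this
  -- A vector orthogonal to all `[x, y]d - d` is fixed by every `[x, y]`, so lies in `S`.
  have hperp : b - b₀ ∈ (Submodule.span ℂ {c | ∃ (p : X × Y) (d : V),
      c = ρ ⁅(p.1 : G), (p.2 : G)⁆ d - d}).topologicalClosure := by
    rw [← Submodule.orthogonal_orthogonal_eq_closure]
    refine Submodule.orthogonal_le ?_ (Submodule.sub_starProjection_mem_orthogonal (K := S) b)
    intro v hv
    have hv' : ∀ p : X × Y, ρ ⁅(p.1 : G), (p.2 : G)⁆⁻¹ v = v := by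
      intro p
      rw [← sub_eq_zero]
      refine ext_inner_left ℂ fun d => ?_
      rw [inner_zero_right, inner_sub_right, ← ρ.inner_apply_left, ← inner_sub_left]
      exact (Submodule.mem_orthogonal _ _).1 hv _ (Submodule.subset_span ⟨p, d, rfl⟩)
    have : v ∈ ρ.fixedSubspace Z := by
      intro z hz
      induction hz using Subgroup.closure_induction with
      | mem z hz =>
        obtain ⟨p, rfl⟩ := hz
        nth_rw 1 [← hv' p]
        exact ρ.self_apply_inv _ v
      | one => simp
      | mul g h _ _ hg hh => rw [ρ.mul_apply, hh, hg]
      | inv g _ hg =>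
        nth_rw 1 [← hg]
        exact ρ.inv_apply_self g v
    exact this
  have h1 := hA.sqrt_mul_norm_inner_le_of_mem_closure ρ hc hn ha
    (sub_mem hb (hproj Y b hb)) hperp
  -- As `b₀ ∈ S`, `a` may be replaced by `a₀`.
  have h2 : inner ℂ a b₀ = 0 := by
    have h3 := Submodule.starProjection_inner_eq_zero a b₀
      (Submodule.starProjection_apply_mem S b) (K := S)
    rwa [inner_sub_left, h0, sub_zero] at h3
  have h3 : ‖b - b₀‖ ≤ ‖b‖ := by
    change ‖b - S.starProjection b‖ ≤ ‖b‖
    rw [← Submodule.starProjection_orthogonal_val]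
    exact Submodule.norm_starProjection_apply_le _ _
  change √n * ‖inner ℂ a (b - b₀)‖ ≤ ‖a‖ * ‖b - b₀‖ at h1
  rw [inner_sub_right, h2, sub_zero] at h1
  exact h1.trans (by gcongr)

end GlobalEstimate

/-! ### Passage from finite `n ≤ m` to `1/√m` -/

theorem le_invSqrt_mul_of_forall_natCast_le {m : ℕ∞} (hm : m ≠ 0) {r t : ℝ}
    (h : ∀ n : ℕ, (n : ℕ∞) ≤ m → √n * r ≤ t) : r ≤ invSqrt m * t := by
  induction m using ENat.recTopCoe with
  | top =>
    have hr : r ≤ 0 := by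
      by_contra! hr
      obtain ⟨n, hn⟩ := exists_nat_gt ((t / r) ^ 2)
      have h1 := h n le_top
      have h2 : t / r < √n := Real.lt_sqrt_of_sq_lt hn
      rw [div_lt_iff₀ hr] at h2
      linarith
    simpa [invSqrt] using hr
  | coe m =>
    have hm' : 0 < √(m : ℝ) := Real.sqrt_pos.2 (by
      exact_mod_cast Nat.pos_of_ne_zero (by simpa using hm))
    have h1 := h m le_rfl
    have h2 : invSqrt (m : ℕ∞) = (√(m : ℝ))⁻¹ := by
      simp [invSqrt]
    rw [h2, inv_mul_eq_div, le_div_iff₀ hm']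
    linarith

/-- Excludes the junk value `invSqrt 0 = 0`, for which the bound would not follow. -/
theorem minProperIndex_ne_zero (R M : Type*) [Ring R] [AddCommGroup M] [Module R M] :
    minProperIndex R M ≠ 0 := by
  refine (lt_of_lt_of_le zero_lt_one (le_iInf fun N => ?_)).ne'
  exact ENat.one_le_card_iff_nonempty _ |>.2 inferInstance

theorem mainTheorem8 {G : Type u} [Group G]
    [Group.IsNilpotent G] (hG : Group.nilpotencyClass G ≤ 2)
    (X Y : Subgroup G) [IsMulCommutative X] [IsMulCommutative Y] (hXY : X ⊔ Y = ⊤)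
    (A : Type w) [Ring A] [Module Aᵐᵒᵖ (Additive X)] [Module A (Additive Y)]
    (hA : IsNoetherianAGroup X Y A) :
    SubgroupsEpsOrthogonal.{u, v} (invSqrt (minProperIndex Aᵐᵒᵖ (Additive X))) X Y := by
  intro V _ _ _ ρ hρ a ha b hb
  rw [mul_assoc]
  exact le_invSqrt_mul_of_forall_natCast_le (minProperIndex_ne_zero _ _) fun n hn =>
    hA.toIsAGroup.sqrt_mul_norm_inner_le ρ
      (commutatorElement_mem_center_of_nilpotencyClass_le_two hG) hXY hρ hn ha hb
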